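/- Let $A_1,\dots,A_N$ be bounded skew-adjoint operators on a Hilbert space, with $\|A_j\|=a_j$. Put $\chi(h)=e^{hA_1}e^{hA_2}\cdots e^{hA_N}$, $\chi^*(h)=e^{hA_N}\cdots e^{hA_2}e^{hA_1}$, $S_2(h)=\chi(h/2)\,\chi^*(h/2)$ and, for $h\ge 0$, $\lambda=h(a_1+\cdots+a_N)$. A family $\Psi(h)$ of bounded operators is said to have order $p$ if $\Psi(h)-e^{h(A_1+\cdots+A_N)}=\mathcal O(h^{p+1})$ as $h\to 0$. For a multi-index $(i_1,\dots,i_m)$ of positive integers, define $w_{i_1,\dots,i_m}$ recursively, with the value $1$ at the empty multi-index, by $$w_{i_1,\dots,i_m}(\alpha_1,\dots,\alpha_{2\ell})=\sum_{j=1}^{\ell}\bigl(\alpha_{2j}^{i_m}-(-\alpha_{2j-1})^{i_m}\bigr)\,w_{i_1,\dots,i_{m-1}}(\alpha_1,\dots,\alpha_{2j-1}),$$ $$w_{i_1,\dots,i_m}(\alpha_1,\dots,\alpha_{2\ell-1})=w_{i_1,\dots,i_m}(\alpha_1,\dots,\alpha_{2\ell-1},0).$$ Let $\epsilon_{i_1,\dots,i_m}=1/m!$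 if $i_1=\cdots=i_m=1$ and $\epsilon_{i_1,\dots,i_m}=0$ otherwise, let $\delta_{i_1,\dots,i_m}=w_{i_1,\dots,i_m}-\epsilon_{i_1,\dots,i_m}$, and for $n\ge 1$ let $$d_n(\alpha_1,\dots,\alpha_{2s})=\sum_{m\ge 1}\ \sum_{i_1+\cdots+i_m=n}\frac{|\delta_{i_1,\dots,i_m}(\alpha_1,\dots,\alpha_{2s})|}{i_1!\cdots i_m!}.$$ (a) Let $(\alpha_1,\dots,\alpha_{2s})\in\mathbb R^{2s}$ and suppose that $\Psi(h)=\chi(\alpha_{2s}h)\,\chi^*(\alpha_{2s-1}h)\cdots\chi(\alpha_2h)\,\chi^*(\alpha_1h)$ has order $p$. Then for all integers $q>p$ and all $h\ge 0$, $$\Bigl\|\Psi(h)-e^{h\sum_{j=1}^N A_j}\Bigr\|\le\sum_{n=p+1}^{q}d_n(\alpha_1,\dots,\alpha_{2s})\,\lambda^n+\frac{1}{(q+1)!}\Bigl[1+2\Bigl(\sum_{i=1}^{2s}|\alpha_i|\Bigr)^{q+1}\Bigr]\lambda^{q+1}.$$ (b) Let $(\gamma_1,\dots,\gamma_s)\in\mathbb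 R^{s}$ and suppose that $\Psi(h)=S_2(\gamma_sh)\cdots S_2(\gamma_2h)\,S_2(\gamma_1h)$ has order $p$. Then for all integers $q\ge p$ and all $h\ge 0$, $$\Bigl\|\Psi(h)-e^{h\sum_{j=1}^N A_j}\Bigr\|\le\sum_{n=p+1}^{q}\hat d_n(\gamma_1,\dots,\gamma_s)\,\lambda^n+\frac{1}{(q+1)!}\Bigl[1+\Bigl(\sum_{i=1}^{s}|\gamma_i|\Bigr)^{q+1}\Bigr]\lambda^{q+1},$$ where $\hat d_n(\gamma_1,\dots,\gamma_s)=d_n\bigl(\tfrac{\gamma_1}{2},\tfrac{\gamma_1}{2},\tfrac{\gamma_2}{2},\tfrac{\gamma_2}{2},\dots,\tfrac{\gamma_s}{2},\tfrac{\gamma_s}{2}\bigr)$. -/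

import Mathlib

open scoped Nat Topology

noncomputable section

namespace Splitting

variable {𝕜 : Type*} [RCLike 𝕜] {H : Type*} [NormedAddCommGroup H] [InnerProductSpace 𝕜 H]
  [CompleteSpace H]

/-- The factors `exp (h A₁), …, exp (h A_N)`, in this order. -/
def factors {N : ℕ} (A : Fin N → H →L[𝕜] H) (h : ℝ) : List (H →L[𝕜] H) :=
  List.ofFn fun j => NormedSpace.exp ((h : 𝕜) • A j)

/-- The Lie-Trotter scheme `χ(h) = exp (h A₁) ⋯ exp (h A_N)`. -/
def chi {N : ℕ} (A : Fin N → H →L[𝕜] H) (h : ℝ) : H →L[𝕜] H :=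
  (factors A h).prod

/-- The adjoint scheme `χ*(h) = exp (h A_N) ⋯ exp (h A₁)`. -/
def chiStar {N : ℕ} (A : Fin N → H →L[𝕜] H) (h : ℝ) : H →L[𝕜] H :=
  (factors A h).reverse.prod

/-- The Strang splitting `S₂(h) = χ(h/2) χ*(h/2)`. -/
def strang {N : ℕ} (A : Fin N → H →L[𝕜] H) (h : ℝ) : H →L[𝕜] H :=
  chi A (h / 2) * chiStar A (h / 2)

/-- The composition `Ψ(h) = χ(α_{2s} h) χ*(α_{2s-1} h) ⋯ χ(α₂ h) χ*(α₁ h)`.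
Coefficients are numbered from one; only `α 1, …, α (2 * s)` are used. -/
def compChi {N : ℕ} (A : Fin N → H →L[𝕜] H) (α : ℕ → ℝ) : ℕ → ℝ → H →L[𝕜] H
  | 0, _ => 1
  | s + 1, h =>
      chi A (α (2 * (s + 1)) * h) * chiStar A (α (2 * (s + 1) - 1) * h) * compChi A α s h

/-- The composition `Ψ(h) = S₂(γ_s h) ⋯ S₂(γ₂ h) S₂(γ₁ h)`.
Coefficients are numbered from one; only `γ 1, …, γ s` are used. -/
def compStrang {N : ℕ} (A : Fin N → H →L[𝕜] H) (γ : ℕ → ℝ) : ℕ → ℝ → H →L[𝕜] H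
  | 0, _ => 1
  | s + 1, h => strang A (γ (s + 1) * h) * compStrang A γ s h

/-- The exact flow `exp (h (A₁ + ⋯ + A_N))`. -/
def flow {N : ℕ} (A : Fin N → H →L[𝕜] H) (h : ℝ) : H →L[𝕜] H :=
  NormedSpace.exp ((h : 𝕜) • ∑ j, A j)

/-- `Ψ` approximates `exp (h (A₁ + ⋯ + A_N))` with order `p`:
`Ψ(h) - exp (h (A₁ + ⋯ + A_N)) = O(h^(p+1))` as `h → 0`. -/
def HasOrder {N : ℕ} (A : Fin N → H →L[𝕜] H) (Ψ : ℝ → H →L[𝕜] H) (p : ℕ) : Prop :=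
  (fun h : ℝ => Ψ h - flow A h) =O[𝓝 0] fun h : ℝ => h ^ (p + 1)

/-- The coefficient function `w_{i₁,…,i_m}(α₁, …, α_{2ℓ})`, with the multi-index given in the
reversed order `[i_m, …, i₁]` and with value `1` at the empty multi-index. The recursion is
`w_{i₁,…,i_m}(α₁,…,α_{2ℓ}) =
  ∑_{j=1}^ℓ (α_{2j}^{i_m} - (-α_{2j-1})^{i_m}) w_{i₁,…,i_{m-1}}(α₁,…,α_{2j-1})`,
where `w(α₁,…,α_{2j-1})` means `w(α₁,…,α_{2j-1},0)`. -/
def wRev : List ℕ → ℕ → (ℕ → ℝ) → ℝ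
  | [], _, _ => 1
  | i :: I, l, α =>
      ∑ j ∈ Finset.Icc 1 l,
        (α (2 * j) ^ i - (-α (2 * j - 1)) ^ i) * wRev I j (Function.update α (2 * j) 0)

/-- `w_{i₁,…,i_m}(α₁, …, α_{2s})` for the multi-index `I = [i₁, …, i_m]`. -/
def w (I : List ℕ) (s : ℕ) (α : ℕ → ℝ) : ℝ := wRev I.reverse s α

/-- `ε_{i₁,…,i_m}`: it is `1 / m!` if all `i_k` are `1`, and `0` otherwise. -/
def eps (I : List ℕ) : ℝ := if ∀ i ∈ I, i = 1 then 1 / (I.length ! : ℝ) else 0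

/-- `δ_{i₁,…,i_m}(α₁, …, α_{2s}) = w_{i₁,…,i_m}(α₁, …, α_{2s}) - ε_{i₁,…,i_m}`. -/
def delta (I : List ℕ) (s : ℕ) (α : ℕ → ℝ) : ℝ := w I s α - eps I

/-- The doubled sequence `(γ₁/2, γ₁/2, γ₂/2, γ₂/2, …)`, numbered from one. -/
def doubled (γ : ℕ → ℝ) (k : ℕ) : ℝ := γ ((k + 1) / 2) / 2

/-- `δ̂_{i₁,…,i_m}(γ₁, …, γ_s) = δ_{i₁,…,i_m}(γ₁/2, γ₁/2, …, γ_s/2, γ_s/2)`. -/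
def deltaHat (I : List ℕ) (s : ℕ) (γ : ℕ → ℝ) : ℝ := delta I s (doubled γ)

/-- `d_n(α₁, …, α_{2s})`: the sum of `|δ_{i₁,…,i_m}| / (i₁! ⋯ i_m!)` over all `m ≥ 1` and all
`m`-tuples of positive integers with `i₁ + ⋯ + i_m = n` (used for `n ≥ 1`). -/
def d (n s : ℕ) (α : ℕ → ℝ) : ℝ :=
  ∑ c : Composition n, |delta c.blocks s α| / (c.blocks.map fun i => (i ! : ℝ)).prod

/-- The analogue of `d` for compositions of the Strang splitting, with `δ̂` in place of `δ`. -/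
def dStrang (n s : ℕ) (γ : ℕ → ℝ) : ℝ :=
  ∑ c : Composition n, |deltaHat c.blocks s γ| / (c.blocks.map fun i => (i ! : ℝ)).prod

end Splitting

end

/-!
The error `Ψ(h) - exp (h Z)`, with `Z = A₁ + ⋯ + A_N`, is compared with its Taylor polynomial of
degree `q` at the origin; the terms of the polynomial give the coefficients `d n`, and the remainder
gives the last summand of the bound.

*Coefficients.* Let `X_i` be the Taylor coefficients of `χ`. As `χ(-h) χ*(h) = 1`, multiplying a
composition by `χ(β h) χ*(α h)` adds `χ(β h) - χ(-α h) = ∑ (β ^ i - (-α) ^ i) h ^ i X_i` times the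
composition with `β` replaced by `0` (`altComp_succ_eq`). Iterating this identity gives the
recursion for `w`, so the `n`-th Taylor coefficient of `Ψ` is the sum over the compositions
`(i₁, …, i_m)` of `n` of `w_{i₁,…,i_m} X_{i_m} ⋯ X_{i₁}` (`taylorCoeff_altComp`). That of
`exp (h X₁)` is the same sum with `ε` in place of `w` (`sum_eps_smul_prod`). Since
`‖X_i‖ ≤ a ^ i / i!` with `a = ∑ ‖A_j‖`, the difference of the two is at most `d n * a ^ n` in norm;
it vanishes for `n ≤ p` because the error is `O(h ^ (p + 1))`
(`taylorCoeff_eq_zero_of_isBigO`).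

*Remainder.* The exponential of a skew-adjoint operator is unitary, so the `n`-th derivative of
`exp (t A_j)` has norm at most `‖A_j‖ ^ n` for every `t`. By the Leibniz rule such bounds add up under
products (`DerivBound.mul`): the `n`-th derivative of `Ψ` is at most `(a ∑ |αᵢ|) ^ n`, and that of
`exp (t Z)` at most `a ^ n`. Taylor's theorem then bounds the remainder by
`(1 + (∑ |αᵢ|) ^ (q + 1)) (h a) ^ (q + 1) / (q + 1)!`. This constant is at most the one asserted
for compositions of `χ` and `χ*`, and as `S₂(γ h) = χ(γ h / 2) χ*(γ h / 2)` it is exactly the one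
asserted for compositions of Strang splittings.
-/

namespace Splitting

open scoped ContDiff
open NormedSpace (exp)
open Finset.HasAntidiagonal (antidiagonal)

/-! ### Taylor coefficients and derivative bounds -/

section Taylor

variable {E : Type*} [NormedAddCommGroup E] [NormedSpace ℝ E]

/-- The `n`-th Taylor coefficient `f⁽ⁿ⁾(0) / n!` of `f` at the origin. -/
noncomputable def taylorCoeff (n : ℕ) (f : ℝ → E) : E := (n ! : ℝ)⁻¹ • iteratedDeriv n f 0

/-- `f` is smooth and its derivatives grow at most geometrically, uniformly on the line:
`‖f⁽ⁿ⁾(t)‖ ≤ bⁿ` for all `n` and `t`. A one-parameter group of isometries with generator of norm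
at most `b` is the basic example, and such bounds add up under multiplication. -/
structure DerivBound (f : ℝ → E) (b : ℝ) : Prop where
  contDiff : ContDiff ℝ ∞ f
  norm_le : ∀ n t, ‖iteratedDeriv n f t‖ ≤ b ^ n

theorem DerivBound.contDiff_nat {f : ℝ → E} {b : ℝ} (hf : DerivBound f b) (n : ℕ) :
    ContDiff ℝ n f :=
  hf.contDiff.of_le (by exact_mod_cast le_top)

theorem taylorCoeff_zero (f : ℝ → E) : taylorCoeff 0 f = f 0 := by
  simp [taylorCoeff]

theorem taylorCoeff_sub {f g : ℝ → E} {b c : ℝ} (hf : DerivBound f b) (hg : DerivBound g c)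
    (n : ℕ) : taylorCoeff n (f - g) = taylorCoeff n f - taylorCoeff n g := by
  rw [taylorCoeff, iteratedDeriv_sub (hf.contDiff_nat n).contDiffAt (hg.contDiff_nat n).contDiffAt,
    smul_sub]
  rfl

theorem taylorCoeff_comp_mul {f : ℝ → E} {b : ℝ} (hf : DerivBound f b) (a : ℝ) (n : ℕ) :
    taylorCoeff n (fun t => f (a * t)) = a ^ n • taylorCoeff n f := by
  rw [taylorCoeff, iteratedDeriv_comp_const_smul (hf.contDiff_nat n), taylorCoeff, smul_comm]
  simp

theorem DerivBound.norm_taylorCoeff_le {f : ℝ → E} {b : ℝ} (hf : DerivBound f b) (n : ℕ) :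
    ‖taylorCoeff n f‖ ≤ b ^ n / (n ! : ℝ) := by
  rw [taylorCoeff, norm_smul, norm_inv, Real.norm_natCast, div_eq_inv_mul]
  gcongr
  exact hf.norm_le n 0

theorem DerivBound.comp_mul {f : ℝ → E} {b : ℝ} (hf : DerivBound f b) (a : ℝ) :
    DerivBound (fun t => f (a * t)) (|a| * b) where
  contDiff := hf.contDiff.comp (contDiff_const.mul contDiff_id)
  norm_le n t := by
    rw [iteratedDeriv_comp_const_smul (hf.contDiff_nat n), norm_smul, norm_pow, Real.norm_eq_abs,
      mul_pow]
    gcongr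
    exact hf.norm_le n _

/-- Taylor's theorem with the sharp constant `1 / n!` for vector-valued functions. -/
theorem norm_sub_taylor_le (n : ℕ) : ∀ (f : ℝ → E), ContDiff ℝ ∞ f → ∀ C : ℝ,
    (∀ t, ‖iteratedDeriv n f t‖ ≤ C) → ∀ h : ℝ, 0 ≤ h →
    ‖f h - ∑ k ∈ Finset.range n, h ^ k • taylorCoeff k f‖ ≤ C * h ^ n / (n ! : ℝ) := by
  induction n with
  | zero =>
    intro f _ C hC h _
    simpa using hC h
  | succ n ih =>
    intro f hf C hC h hh
    obtain ⟨hdiff, hderiv⟩ := contDiff_infty_iff_deriv.1 hf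
    have key : ∀ x : ℝ, HasDerivAt
        (fun t => f t - ∑ k ∈ Finset.range (n + 1), t ^ k • taylorCoeff k f)
        (deriv f x - ∑ k ∈ Finset.range n, x ^ k • taylorCoeff k (deriv f)) x := by
      intro x
      refine (hdiff x).hasDerivAt.sub ?_
      have hs : HasDerivAt (fun t : ℝ => ∑ k ∈ Finset.range (n + 1), t ^ k • taylorCoeff k f)
          (∑ k ∈ Finset.range (n + 1), ((k : ℝ) * x ^ (k - 1)) • taylorCoeff k f) x :=
        HasDerivAt.fun_sum fun k _ => (hasDerivAt_pow k x).smul_const _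
      convert hs using 1
      rw [Finset.sum_range_succ']
      simp only [Nat.cast_zero, zero_mul, zero_smul, add_zero]
      refine Finset.sum_congr rfl fun k _ => ?_
      simp only [taylorCoeff, iteratedDeriv_succ', smul_smul, Nat.factorial_succ,
        Nat.add_sub_cancel]
      congr 1
      push_cast
      have : (k : ℝ) + 1 ≠ 0 := by positivity
      field_simp
    have hB : ∀ x : ℝ, HasDerivAt (fun t : ℝ => C * t ^ (n + 1) / ((n + 1)! : ℝ))
        (C * x ^ n / (n ! : ℝ)) x := by
      intro x
      refine (((hasDerivAt_pow (n + 1) x).const_mul C).div_const ((n + 1)! : ℝ)).congr_deriv ?_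
      rw [Nat.factorial_succ, Nat.add_sub_cancel]
      push_cast
      have : (n : ℝ) + 1 ≠ 0 := by positivity
      field_simp
    refine image_norm_le_of_norm_deriv_right_le_deriv_boundary (a := 0) (b := h)
      (fun x _ => (key x).continuousAt.continuousWithinAt)
      (fun x _ => (key x).hasDerivWithinAt) ?_ hB
      (fun x hx => ih (deriv f) hderiv C (fun t => by rw [← iteratedDeriv_succ']; exact hC t)
        x hx.1) ⟨hh, le_rfl⟩
    simp [Finset.sum_range_succ', taylorCoeff_zero]

theorem DerivBound.norm_sub_taylor_le {f : ℝ → E} {b : ℝ} (hf : DerivBound f b) (n : ℕ) {h : ℝ}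
    (hh : 0 ≤ h) : ‖f h - ∑ k ∈ Finset.range n, h ^ k • taylorCoeff k f‖ ≤
      1 / (n ! : ℝ) * b ^ n * h ^ n := by
  refine (Splitting.norm_sub_taylor_le n f hf.contDiff _ (hf.norm_le n) h hh).trans_eq ?_
  ring

/-- The Taylor coefficients up to order `p` of a smooth `O(h ^ (p + 1))` function vanish. -/
theorem taylorCoeff_eq_zero_of_isBigO {f : ℝ → E} (hf : ContDiff ℝ ∞ f) {p : ℕ}
    (hO : f =O[𝓝 0] fun h : ℝ => h ^ (p + 1)) : ∀ n ≤ p, taylorCoeff n f = 0 := by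
  intro n
  induction n using Nat.strong_induction_on with
  | _ n ih =>
    intro hn
    -- By induction the Taylor polynomial of degree `n` reduces to its last term.
    have ht := taylor_isLittleO_univ (x₀ := 0) (n := n)
      (hf.of_le (by exact_mod_cast le_top) : ContDiff ℝ n f)
    have hsum : ∀ x, taylorWithinEval f n Set.univ 0 x = x ^ n • taylorCoeff n f := by
      intro x
      rw [taylor_within_apply, Finset.sum_eq_single n]
      · simp [taylorCoeff, smul_smul, mul_comm, iteratedDerivWithin_univ]
      · intro k hk hkn
        have hk' : k < n := by simp at hk; omega
        have h0 := ih k hk' (by omega)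
        rw [taylorCoeff] at h0
        rw [iteratedDerivWithin_univ, mul_comm, mul_smul, h0, smul_zero]
      · simp
    have hpow : (fun h : ℝ => h ^ (p + 1)) =o[𝓝 0] fun h : ℝ => h ^ n :=
      Asymptotics.isLittleO_pow_pow (by omega)
    have h1 : (fun x : ℝ => x ^ n • taylorCoeff n f) =o[𝓝 0] fun x : ℝ => x ^ n := by
      have := (hO.trans_isLittleO hpow).sub (by simpa only [hsum, sub_zero] using ht)
      simpa using this
    -- Along `x ≠ 0` the factor `x ^ n` cancels, so the constant coefficient tends to `0`.
    have h2 : (fun _ : ℝ => taylorCoeff n f) =o[𝓝[≠] (0 : ℝ)] fun _ : ℝ => (1 : ℝ) := by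
      refine ((Asymptotics.isBigO_refl (fun x : ℝ => (x ^ n)⁻¹) (𝓝[≠] 0)).smul_isLittleO
        (h1.mono nhdsWithin_le_nhds)).congr' ?_ ?_
      · filter_upwards [self_mem_nhdsWithin] with x hx
        rw [smul_smul, inv_mul_cancel₀ (pow_ne_zero n hx), one_smul]
      · filter_upwards [self_mem_nhdsWithin] with x hx
        rw [smul_eq_mul, inv_mul_cancel₀ (pow_ne_zero n hx)]
    exact tendsto_nhds_unique tendsto_const_nhds ((Asymptotics.isLittleO_one_iff ℝ).1 h2)

end Taylor

section Algebra

variable {R : Type*} [NormedRing R] [NormedAlgebra ℝ R]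

theorem DerivBound.one (h1 : ‖(1 : R)‖ ≤ 1) : DerivBound (1 : ℝ → R) 0 where
  contDiff := contDiff_const
  norm_le n t := by
    have : iteratedDeriv n (1 : ℝ → R) t = if n = 0 then 1 else 0 := iteratedDeriv_const
    rw [this]
    split_ifs with hn <;> simp [hn, h1]

theorem DerivBound.mul {f g : ℝ → R} {b c : ℝ} (hf : DerivBound f b) (hg : DerivBound g c) :
    DerivBound (f * g) (b + c) where
  contDiff := hf.contDiff.mul hg.contDiff
  norm_le n t := by
    have h := norm_iteratedFDeriv_mul_le hf.contDiff hg.contDiff t (n := n)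
      (by exact_mod_cast le_top)
    simp only [norm_iteratedFDeriv_eq_norm_iteratedDeriv] at h
    refine h.trans ?_
    rw [add_pow]
    refine Finset.sum_le_sum fun i _ => ?_
    calc (n.choose i : ℝ) * ‖iteratedDeriv i f t‖ * ‖iteratedDeriv (n - i) g t‖
        ≤ (n.choose i : ℝ) * b ^ i * c ^ (n - i) := by
          have hb : 0 ≤ b ^ i := (norm_nonneg _).trans (hf.norm_le i t)
          gcongr
          · exact hf.norm_le i t
          · exact hg.norm_le (n - i) t
      _ = b ^ i * c ^ (n - i) * (n.choose i : ℝ) := by ring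

theorem taylorCoeff_mul {f g : ℝ → R} (hf : ContDiff ℝ ∞ f) (hg : ContDiff ℝ ∞ g) (n : ℕ) :
    taylorCoeff n (f * g) =
      ∑ p ∈ antidiagonal n, taylorCoeff p.1 f * taylorCoeff p.2 g := by
  rw [Finset.Nat.sum_antidiagonal_eq_sum_range_succ_mk, taylorCoeff,
    iteratedDeriv_mul (hf.of_le (by exact_mod_cast le_top)).contDiffAt
      (hg.of_le (by exact_mod_cast le_top)).contDiffAt, Finset.smul_sum]
  refine Finset.sum_congr rfl fun i hi => ?_
  have hi' : i ≤ n := by simp at hi; omega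
  rw [taylorCoeff, taylorCoeff, smul_mul_smul_comm, mul_assoc, ← nsmul_eq_mul,
    ← Nat.cast_smul_eq_nsmul ℝ, smul_smul, Nat.cast_choose ℝ hi']
  congr 1
  field_simp

/-- For a product of smooth functions with value `1` at the origin the linear Taylor coefficients
add up. -/
theorem taylorCoeff_one_list_prod (L : List (ℝ → R)) (hL : ∀ f ∈ L, ContDiff ℝ ∞ f ∧ f 0 = 1) :
    ContDiff ℝ ∞ L.prod ∧ L.prod 0 = 1 ∧ taylorCoeff 1 L.prod = (L.map (taylorCoeff 1)).sum := by
  induction L with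
  | nil => exact ⟨contDiff_const, rfl, by simp [taylorCoeff, iteratedDeriv_one, Pi.one_def]⟩
  | cons f L ih =>
    simp only [List.forall_mem_cons] at hL
    obtain ⟨h1, h2, h3⟩ := ih hL.2
    refine ⟨hL.1.1.mul h1, by simp [hL.1.2, h2], ?_⟩
    rw [List.prod_cons, taylorCoeff_mul hL.1.1 h1, List.map_cons, List.sum_cons, ← h3]
    simp [Finset.Nat.antidiagonal_succ, taylorCoeff_zero, hL.1.2, h2, add_comm]

theorem DerivBound.list_prod (h1 : ‖(1 : R)‖ ≤ 1) :
    ∀ L : List ((ℝ → R) × ℝ), (∀ x ∈ L, DerivBound x.1 x.2) →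
      DerivBound (L.map Prod.fst).prod (L.map Prod.snd).sum
  | [], _ => by simpa using DerivBound.one h1
  | x :: L, hL => by
    simp only [List.forall_mem_cons] at hL
    simpa using hL.1.mul (DerivBound.list_prod h1 L hL.2)

variable [CompleteSpace R]

theorem iteratedDeriv_exp_smul (X : R) (n : ℕ) :
    iteratedDeriv n (fun t : ℝ => exp (t • X)) = fun t => X ^ n * exp (t • X) := by
  induction n with
  | zero => simp
  | succ n ih =>
    rw [iteratedDeriv_succ, ih]
    funext t
    rw [((hasDerivAt_exp_smul_const' X t).const_mul (X ^ n)).deriv, pow_succ, mul_assoc]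

theorem taylorCoeff_exp_smul (X : R) (n : ℕ) :
    taylorCoeff n (fun t : ℝ => exp (t • X)) = (n ! : ℝ)⁻¹ • X ^ n := by
  simp [taylorCoeff, iteratedDeriv_exp_smul]

theorem DerivBound.exp_smul {X : R} {b : ℝ} (hb : ‖X‖ ≤ b)
    (hX : ∀ t : ℝ, ‖exp (t • X)‖ ≤ 1) : DerivBound (fun t : ℝ => exp (t • X)) b where
  contDiff := by
    refine contDiff_infty.2 fun n => contDiff_of_differentiable_iteratedDeriv fun m _ => ?_
    rw [iteratedDeriv_exp_smul]
    exact fun t => ((hasDerivAt_exp_smul_const' X t).const_mul (X ^ m)).differentiableAt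
  norm_le n t := by
    rw [iteratedDeriv_exp_smul]
    rcases n with _ | n
    · simpa using hX t
    · calc ‖X ^ (n + 1) * exp (t • X)‖ ≤ ‖X ^ (n + 1)‖ * ‖exp (t • X)‖ := norm_mul_le _ _
        _ ≤ ‖X ^ (n + 1)‖ * 1 := by gcongr; exact hX t
        _ ≤ b ^ (n + 1) := by
          rw [mul_one]
          exact (norm_pow_le' X n.succ_pos).trans (by gcongr)

end Algebra

/-! ### Sums over compositions -/

/-- A composition of `n + 1` consists of a first block and a composition of what is left. -/
theorem sum_composition_succ {M : Type*} [AddCommMonoid M] (F : List ℕ → M) (n : ℕ) :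
    ∑ c : Composition (n + 1), F c.blocks =
      ∑ p ∈ antidiagonal n, ∑ c : Composition p.2, F ((p.1 + 1) :: c.blocks) := by
  rw [Finset.sum_sigma']
  symm
  refine Finset.sum_bij
    (fun x hx => ⟨(x.1.1 + 1) :: x.2.blocks, ?_, ?_⟩) ?_ ?_ ?_ ?_
  · intro i hi
    rcases List.mem_cons.1 hi with rfl | hi
    · omega
    · exact x.2.blocks_pos hi
  · have := Finset.HasAntidiagonal.mem_antidiagonal.1 (Finset.mem_sigma.1 hx).1
    rw [List.sum_cons, x.2.blocks_sum]
    omega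
  · intros
    exact Finset.mem_univ _
  · rintro ⟨⟨i, k⟩, c⟩ _ ⟨⟨i', k'⟩, c'⟩ _ h
    simp only [Composition.mk.injEq, List.cons.injEq, Nat.add_right_cancel_iff] at h
    obtain ⟨rfl, h⟩ := h
    obtain rfl : k = k' := by
      have h1 := c.blocks_sum
      have h2 := c'.blocks_sum
      simp only at h1 h2
      rw [← h1, h, h2]
    obtain rfl : c = c' := Composition.ext h
    rfl
  · rintro ⟨l, hpos, hsum⟩ _
    cases l with
    | nil => simp at hsum
    | cons i l =>
      have hi : 0 < i := hpos (by simp)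
      refine ⟨⟨(i - 1, l.sum), ⟨l, fun h => hpos (by simp [h]), rfl⟩⟩, ?_, ?_⟩
      · simp only [List.sum_cons] at hsum
        simp only [Finset.mem_sigma, Finset.HasAntidiagonal.mem_antidiagonal, Finset.mem_univ, and_true]
        omega
      · simp only [Composition.mk.injEq, List.cons.injEq, and_true]
        omega
  · intros
    rfl

theorem sum_composition_reverse {M : Type*} [AddCommMonoid M] (F : List ℕ → M) (n : ℕ) :
    ∑ c : Composition n, F c.blocks.reverse = ∑ c : Composition n, F c.blocks :=
  Fintype.sum_bijective Composition.reverse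
    (Function.Involutive.bijective Composition.reverse_reverse) _ _ fun _ => rfl

theorem sum_composition_zero {M : Type*} [AddCommMonoid M] (F : List ℕ → M) :
    ∑ c : Composition 0, F c.blocks = F [] := by
  rw [Fintype.sum_eq_single (Composition.ones 0)]
  · simp
  · intro c hc
    exact (hc (Composition.eq_ones_iff_length.2 (Nat.le_zero.1 c.length_le))).elim

theorem eps_reverse (I : List ℕ) : eps I.reverse = eps I := by
  simp [eps]

/-- The coefficients `ε` are those of the exponential series: only the composition into ones
contributes. -/
theorem sum_eps_smul_prod {R : Type*} [Ring R] [Module ℝ R] (X : ℕ → R) (n : ℕ) :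
    ∑ c : Composition n, eps c.blocks • (c.blocks.map X).prod = (n ! : ℝ)⁻¹ • X 1 ^ n := by
  rw [Finset.sum_eq_single (Composition.ones n)]
  · simp +contextual [eps, Composition.ones_blocks]
  · intro c _ hc
    rw [eps, if_neg fun h => hc (Composition.eq_ones_iff.2 h), zero_smul]
  · simp

/-- A word `X_{i₁} ⋯ X_{i_m}` is bounded by `a ^ (i₁ + ⋯ + i_m) / (i₁! ⋯ i_m!)`, which explains the
weights in `d`. -/
theorem norm_list_map_prod_le {R : Type*} [NormedRing R] (h1 : ‖(1 : R)‖ ≤ 1) {X : ℕ → R} {a : ℝ}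
    (hX : ∀ n, ‖X n‖ ≤ a ^ n / (n ! : ℝ)) (I : List ℕ) :
    ‖(I.map X).prod‖ ≤ a ^ I.sum / (I.map fun i => (i ! : ℝ)).prod := by
  induction I with
  | nil => simpa using h1
  | cons i I ih =>
    simp only [List.map_cons, List.prod_cons, List.sum_cons, pow_add]
    rw [mul_div_mul_comm]
    exact (norm_mul_le _ _).trans
      (mul_le_mul (hX i) ih (norm_nonneg _) ((norm_nonneg _).trans (hX i)))

/-! ### Alternating compositions of a scheme and its adjoint -/

section AltComp

variable {R : Type*} [NormedRing R]

/-- The composition `χ(α_{2s} h) χ*(α_{2s-1} h) ⋯ χ(α₂ h) χ*(α₁ h)` for arbitrary functions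
`χ` and `χ* = χs` with values in a ring. -/
def altComp (χ χs : ℝ → R) (α : ℕ → ℝ) : ℕ → ℝ → R
  | 0 => 1
  | s + 1 => (fun h => χ (α (2 * (s + 1)) * h)) * (fun h => χs (α (2 * (s + 1) - 1) * h)) *
      altComp χ χs α s

variable {χ χs : ℝ → R}

theorem altComp_congr {α β : ℕ → ℝ} (s : ℕ) (h : ∀ i ≤ 2 * s, α i = β i) :
    altComp χ χs α s = altComp χ χs β s := by
  induction s with
  | zero => rfl
  | succ s ih =>
    rw [altComp, altComp, ih fun i hi => h i (by omega), h _ le_rfl, h (2 * (s + 1) - 1) (by omega)]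

/-- Consecutive compositions differ by `χ(α_{2s+2} h) - χ(-α_{2s+1} h)` times the composition
in which the last coefficient is set to zero. This rests on `χ(-h) χ*(h) = 1`, and is the origin
of the recursion that defines the coefficients `w`. -/
theorem altComp_succ_eq (h0 : χ 0 = 1) (hinv : ∀ h, χ (-h) * χs h = 1) (α : ℕ → ℝ) (s : ℕ) :
    altComp χ χs α (s + 1) = altComp χ χs α s +
      ((fun h => χ (α (2 * (s + 1)) * h)) - fun h => χ (-α (2 * (s + 1) - 1) * h)) *
        altComp χ χs (Function.update α (2 * (s + 1)) 0) (s + 1) := by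
  have hs : altComp χ χs (Function.update α (2 * (s + 1)) 0) s = altComp χ χs α s :=
    altComp_congr s fun i hi => Function.update_of_ne (by omega) _ _
  have hne : 2 * (s + 1) - 1 ≠ 2 * (s + 1) := by omega
  funext h
  simp only [altComp, hs, Pi.add_apply, Pi.mul_apply, Pi.sub_apply, Function.update_self,
    Function.update_of_ne hne, zero_mul, h0, one_mul, sub_mul]
  rw [← mul_assoc (χ (-α (2 * (s + 1) - 1) * h)), neg_mul, hinv, one_mul, mul_assoc]
  abel

variable [NormedAlgebra ℝ R] {a : ℝ}

theorem DerivBound.altComp (h1 : ‖(1 : R)‖ ≤ 1) (hχ : DerivBound χ a) (hχs : DerivBound χs a)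
    (α : ℕ → ℝ) (s : ℕ) :
    DerivBound (altComp χ χs α s) ((∑ i ∈ Finset.Icc 1 (2 * s), |α i|) * a) := by
  induction s with
  | zero => simpa [Splitting.altComp] using DerivBound.one h1
  | succ s ih =>
    convert! ((hχ.comp_mul (α (2 * (s + 1)))).mul (hχs.comp_mul (α (2 * (s + 1) - 1)))).mul ih
      using 1
    rw [show 2 * (s + 1) = 2 * s + 1 + 1 by ring, Finset.sum_Icc_succ_top (by omega),
      Finset.sum_Icc_succ_top (by omega), Nat.add_sub_cancel]
    ring

theorem taylorCoeff_altComp_succ (h1 : ‖(1 : R)‖ ≤ 1) (hχ : DerivBound χ a)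
    (hχs : DerivBound χs a) (h0 : χ 0 = 1) (hinv : ∀ h, χ (-h) * χs h = 1) (n : ℕ) (α : ℕ → ℝ)
    (l : ℕ) : taylorCoeff (n + 1) (altComp χ χs α l) =
      ∑ j ∈ Finset.Icc 1 l, ∑ p ∈ antidiagonal n,
        (α (2 * j) ^ (p.1 + 1) - (-α (2 * j - 1)) ^ (p.1 + 1)) •
          (taylorCoeff (p.1 + 1) χ *
            taylorCoeff p.2 (altComp χ χs (Function.update α (2 * j) 0) j)) := by
  induction l with
  | zero => simp [altComp, taylorCoeff, Pi.one_def, iteratedDeriv_const]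
  | succ l ih =>
    have hs := hχ.comp_mul (α (2 * (l + 1)))
    have ht := hχ.comp_mul (-α (2 * (l + 1) - 1))
    have hu := DerivBound.altComp h1 hχ hχs (Function.update α (2 * (l + 1)) 0) (l + 1)
    have hd : ContDiff ℝ ∞ ((fun h => χ (α (2 * (l + 1)) * h)) -
        fun h => χ (-α (2 * (l + 1) - 1) * h)) := hs.contDiff.sub ht.contDiff
    rw [Finset.sum_Icc_succ_top (by omega), ← ih, ← sub_eq_iff_eq_add',
      ← taylorCoeff_sub (hχ.altComp h1 hχs α _) (hχ.altComp h1 hχs α _),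
      sub_eq_iff_eq_add'.2 (altComp_succ_eq h0 hinv α l),
      taylorCoeff_mul hd hu.contDiff, Finset.Nat.sum_antidiagonal_succ,
      taylorCoeff_zero]
    simp only [Pi.sub_apply, mul_zero, sub_self, zero_mul, zero_add]
    refine Finset.sum_congr rfl fun p _ => ?_
    rw [taylorCoeff_sub hs ht, taylorCoeff_comp_mul hχ, taylorCoeff_comp_mul hχ, ← sub_smul,
      smul_mul_assoc]

/-- The Taylor coefficients of an alternating composition: the coefficient of the word
`X_{i_m} ⋯ X_{i_1}` in the Taylor coefficients `X_i` of `χ` is `w_{i_1, …, i_m}`. -/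
theorem taylorCoeff_altComp (h1 : ‖(1 : R)‖ ≤ 1) (hχ : DerivBound χ a) (hχs : DerivBound χs a)
    (h0 : χ 0 = 1) (hs0 : χs 0 = 1) (hinv : ∀ h, χ (-h) * χs h = 1) (n : ℕ) :
    ∀ (α : ℕ → ℝ) (l : ℕ), taylorCoeff n (altComp χ χs α l) =
      ∑ c : Composition n, wRev c.blocks l α •
        (c.blocks.map fun i => taylorCoeff i χ).prod := by
  induction n using Nat.strong_induction_on with
  | _ n ih =>
    intro α l
    rcases n with _ | n
    · rw [sum_composition_zero fun I => wRev I l α • (I.map fun i => taylorCoeff i χ).prod,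
        taylorCoeff_zero]
      simp only [wRev, List.map_nil, List.prod_nil, one_smul]
      induction l with
      | zero => rfl
      | succ l ihl => simp [altComp, h0, hs0, ihl]
    · rw [taylorCoeff_altComp_succ h1 hχ hχs h0 hinv,
        sum_composition_succ fun I => wRev I l α • (I.map fun i => taylorCoeff i χ).prod,
        Finset.sum_comm]
      refine Finset.sum_congr rfl fun p hp => ?_
      have hp' := Finset.HasAntidiagonal.mem_antidiagonal.1 hp
      simp only [wRev, List.map_cons, List.prod_cons, Finset.sum_smul]
      rw [Finset.sum_comm]
      refine Finset.sum_congr rfl fun j _ => ?_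
      rw [ih p.2 (by omega), Finset.mul_sum, Finset.smul_sum]
      exact Finset.sum_congr rfl fun c _ => by rw [mul_smul_comm, smul_smul]

theorem d_eq_sum_wRev (n s : ℕ) (α : ℕ → ℝ) :
    d n s α = ∑ c : Composition n, |wRev c.blocks s α - eps c.blocks| /
      (c.blocks.map fun i => (i ! : ℝ)).prod := by
  rw [← sum_composition_reverse fun I => |wRev I s α - eps I| / (I.map fun i => (i ! : ℝ)).prod]
  refine Finset.sum_congr rfl fun c _ => ?_
  rw [delta, w, eps_reverse, List.map_reverse, List.prod_reverse]

/-- The error bound for an alternating composition `Ψ` of `χ` and `χ*` that has order `p` as an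
approximation of `exp (h Z)`, where `Z` is the derivative of `χ` at the origin. -/
theorem norm_altComp_sub_exp_le [CompleteSpace R] (h1 : ‖(1 : R)‖ ≤ 1) (hχ : DerivBound χ a)
    (hχs : DerivBound χs a) (h0 : χ 0 = 1) (hs0 : χs 0 = 1) (hinv : ∀ h, χ (-h) * χs h = 1)
    {Z : R} (hZ : taylorCoeff 1 χ = Z)
    (hexp : DerivBound (fun h : ℝ => exp (h • Z)) a) (α : ℕ → ℝ) (s : ℕ) {p : ℕ}
    (q : ℕ)
    (hord : (fun h : ℝ => altComp χ χs α s h - exp (h • Z)) =O[𝓝 0]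
      fun h : ℝ => h ^ (p + 1)) {h : ℝ} (hh : 0 ≤ h) :
    ‖altComp χ χs α s h - exp (h • Z)‖ ≤
      (∑ n ∈ Finset.Icc (p + 1) q, d n s α * (h * a) ^ n) +
        1 / ((q + 1)! : ℝ) * (1 + (∑ i ∈ Finset.Icc 1 (2 * s), |α i|) ^ (q + 1)) *
          (h * a) ^ (q + 1) := by
  set f : ℝ → R := altComp χ χs α s with hf
  set g : ℝ → R := fun h : ℝ => exp (h • Z) with hg
  have hfb : DerivBound f _ := hχ.altComp h1 hχs α s
  have hc : ∀ n, taylorCoeff n f - taylorCoeff n g = ∑ c : Composition n,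
      (wRev c.blocks s α - eps c.blocks) •
        (c.blocks.map fun i => taylorCoeff i χ).prod := by
    intro n
    simp only [sub_smul, Finset.sum_sub_distrib]
    rw [hf, hg, taylorCoeff_altComp h1 hχ hχs h0 hs0 hinv, taylorCoeff_exp_smul,
      sum_eps_smul_prod (fun i => taylorCoeff i χ), hZ]
  have hcn : ∀ n, ‖taylorCoeff n f - taylorCoeff n g‖ ≤ d n s α * a ^ n := by
    intro n
    rw [hc, d_eq_sum_wRev, Finset.sum_mul]
    refine (norm_sum_le _ _).trans (Finset.sum_le_sum fun c _ => ?_)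
    rw [norm_smul, Real.norm_eq_abs, div_mul_eq_mul_div, mul_div_assoc]
    have hw := norm_list_map_prod_le h1 hχ.norm_taylorCoeff_le c.blocks
    rw [c.blocks_sum] at hw
    gcongr
  have hlow : ∀ n ≤ p, taylorCoeff n f - taylorCoeff n g = 0 := by
    intro n hn
    rw [← taylorCoeff_sub hfb hexp]
    exact taylorCoeff_eq_zero_of_isBigO (hfb.contDiff.sub hexp.contDiff) hord n hn
  have hsplit : f h - g h =
      (∑ k ∈ Finset.range (q + 1), h ^ k • (taylorCoeff k f - taylorCoeff k g)) +
      ((f h - ∑ k ∈ Finset.range (q + 1), h ^ k • taylorCoeff k f) -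
        (g h - ∑ k ∈ Finset.range (q + 1), h ^ k • taylorCoeff k g)) := by
    simp only [smul_sub, Finset.sum_sub_distrib]
    abel
  have hpoly : ‖∑ k ∈ Finset.range (q + 1), h ^ k • (taylorCoeff k f - taylorCoeff k g)‖ ≤
      ∑ n ∈ Finset.Icc (p + 1) q, d n s α * (h * a) ^ n := by
    have hsub : Finset.Icc (p + 1) q ⊆ Finset.range (q + 1) := by
      intro k
      simp only [Finset.mem_Icc, Finset.mem_range]
      omega
    rw [← Finset.sum_subset hsub fun k hk hk' => by
      simp only [Finset.mem_Icc, Finset.mem_range] at hk hk'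
      rw [hlow k (by omega), smul_zero]]
    refine (norm_sum_le _ _).trans (Finset.sum_le_sum fun k _ => ?_)
    rw [norm_smul, Real.norm_of_nonneg (pow_nonneg hh k), mul_pow, mul_left_comm]
    gcongr
    exact hcn k
  rw [hsplit]
  refine (norm_add_le _ _).trans (add_le_add hpoly ((norm_sub_le _ _).trans ((add_le_add
    (hfb.norm_sub_taylor_le (q + 1) hh) (hexp.norm_sub_taylor_le (q + 1) hh)).trans_eq ?_)))
  ring

end AltComp

/-! ### Products of exponentials -/

section ExpProd

variable {R : Type*} [NormedRing R] [NormedAlgebra ℝ R]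

/-- The product `exp (h X₁) ⋯ exp (h X_N)` for a list `X₁, …, X_N`. -/
noncomputable def expProd (L : List R) (h : ℝ) : R := (L.map fun X => exp (h • X)).prod

theorem expProd_zero (L : List R) : expProd L 0 = 1 := by
  simp [expProd]

theorem expProd_eq_prod (L : List R) :
    expProd L = (L.map fun X => fun h : ℝ => exp (h • X)).prod := by
  funext h
  induction L with
  | nil => rfl
  | cons X L ih =>
    rw [List.map_cons, List.prod_cons, Pi.mul_apply, ← ih]
    simp [expProd]

variable [CompleteSpace R]

theorem expProd_neg_mul_reverse (L : List R) (h : ℝ) :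
    expProd L (-h) * expProd L.reverse h = 1 := by
  let _ : NormedAlgebra ℚ R := NormedAlgebra.restrictScalars ℚ ℝ R
  induction L with
  | nil => simp [expProd]
  | cons X L ih =>
    have hX : exp (-h • X) * exp (h • X) = 1 := by
      rw [← NormedSpace.exp_add_of_commute (((Commute.refl X).smul_left _).smul_right _),
        ← add_smul, neg_add_cancel, zero_smul, NormedSpace.exp_zero]
    calc expProd (X :: L) (-h) * expProd (X :: L).reverse h
        = exp (-h • X) * (expProd L (-h) * expProd L.reverse h) * exp (h • X) := by
          simp only [expProd, List.map_cons, List.prod_cons, List.reverse_cons, List.map_append,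
            List.prod_append, List.map_nil, List.prod_nil, mul_one, mul_assoc]
      _ = 1 := by rw [ih, mul_one, hX]

theorem DerivBound.expProd (h1 : ‖(1 : R)‖ ≤ 1) (L : List R)
    (hL : ∀ X ∈ L, ∀ t : ℝ, ‖exp (t • X)‖ ≤ 1) :
    DerivBound (expProd L) (L.map norm).sum := by
  have h := DerivBound.list_prod h1 (L.map fun X => (fun h : ℝ => exp (h • X), ‖X‖)) (by
    simp only [List.forall_mem_map]
    exact fun X hX => DerivBound.exp_smul le_rfl (hL X hX))
  rw [List.map_map, List.map_map] at h
  rw [expProd_eq_prod]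
  exact h

theorem taylorCoeff_one_expProd (L : List R) (hL : ∀ X ∈ L, ∀ t : ℝ, ‖exp (t • X)‖ ≤ 1) :
    taylorCoeff 1 (expProd L) = L.sum := by
  rw [expProd_eq_prod, (taylorCoeff_one_list_prod _ _).2.2, List.map_map]
  · congr 1
    exact (List.map_congr_left fun X _ => by simp [taylorCoeff_exp_smul]).trans (List.map_id L)
  · simp only [List.forall_mem_map]
    exact fun X hX => ⟨(DerivBound.exp_smul le_rfl (hL X hX)).contDiff, by simp⟩

end ExpProd

/-! ### Skew-adjoint operators -/

section SkewAdjoint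

variable {R : Type*} [NormedRing R] [NormedAlgebra ℝ R] [StarRing R] [CStarRing R]
  [StarModule ℝ R] [CompleteSpace R]

theorem norm_exp_smul_le_one_of_mem_skewAdjoint {X : R} (hX : X ∈ skewAdjoint R) (t : ℝ) :
    ‖exp (t • X)‖ ≤ 1 := by
  let _ : NormedAlgebra ℚ R := NormedAlgebra.restrictScalars ℚ ℝ R
  rcases subsingleton_or_nontrivial R with _ | _
  · simp [Subsingleton.elim (exp (t • X)) 0]
  · exact (CStarRing.norm_of_mem_unitary
      (NormedSpace.exp_mem_unitary_of_mem_skewAdjoint (skewAdjoint.smul_mem t hX))).le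

/-- The error bound in any C⋆-algebra: exponentials of skew-adjoint elements are unitary, so the
derivatives of both `χ` and `χ*` are bounded by powers of `∑ ‖A j‖`. -/
theorem norm_altComp_expProd_sub_exp_le {N : ℕ} (A : Fin N → R)
    (hA : ∀ j, A j ∈ skewAdjoint R) (α : ℕ → ℝ) (s : ℕ) {p : ℕ} (q : ℕ)
    (hord : (fun h : ℝ => altComp (expProd (List.ofFn A)) (expProd (List.ofFn A).reverse) α s h -
      exp (h • ∑ j, A j)) =O[𝓝 0] fun h : ℝ => h ^ (p + 1)) {h : ℝ} (hh : 0 ≤ h) :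
    ‖altComp (expProd (List.ofFn A)) (expProd (List.ofFn A).reverse) α s h -
        exp (h • ∑ j, A j)‖ ≤
      (∑ n ∈ Finset.Icc (p + 1) q, d n s α * (h * ∑ j, ‖A j‖) ^ n) +
        1 / ((q + 1)! : ℝ) * (1 + (∑ i ∈ Finset.Icc 1 (2 * s), |α i|) ^ (q + 1)) *
          (h * ∑ j, ‖A j‖) ^ (q + 1) := by
  have h1 : ‖(1 : R)‖ ≤ 1 := by
    simpa using norm_exp_smul_le_one_of_mem_skewAdjoint (zero_mem (skewAdjoint R)) 0
  have hL : ∀ X ∈ List.ofFn A, ∀ t : ℝ, ‖exp (t • X)‖ ≤ 1 := by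
    intro X hX
    obtain ⟨j, rfl⟩ := (List.mem_ofFn' A X).1 hX
    exact norm_exp_smul_le_one_of_mem_skewAdjoint (hA j)
  have hsum : ((List.ofFn A).map norm).sum = ∑ j, ‖A j‖ := by
    rw [List.map_ofFn, List.sum_ofFn]
    rfl
  have hχ := DerivBound.expProd h1 _ hL
  have hχs := DerivBound.expProd h1 (List.ofFn A).reverse fun X hX => hL X (List.mem_reverse.1 hX)
  rw [List.map_reverse, List.sum_reverse, hsum] at hχs
  rw [hsum] at hχ
  exact norm_altComp_sub_exp_le h1 hχ hχs (expProd_zero _) (expProd_zero _)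
    (expProd_neg_mul_reverse _) ((taylorCoeff_one_expProd _ hL).trans (List.sum_ofFn (f := A)))
    (DerivBound.exp_smul (norm_sum_le _ _)
      (norm_exp_smul_le_one_of_mem_skewAdjoint (sum_mem fun j _ => hA j))) α s q hord hh

end SkewAdjoint

/-! ### Splitting schemes on a Hilbert space -/

section Hilbert

variable {𝕜 : Type*} [RCLike 𝕜] {H : Type*} [NormedAddCommGroup H] [InnerProductSpace 𝕜 H]
  {N : ℕ}

/-- A composition of Strang splittings is an alternating composition of `χ` and `χ*` with doubled
and halved coefficients, so its error bound is a special case. -/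
theorem compStrang_eq_compChi (A : Fin N → H →L[𝕜] H) (γ : ℕ → ℝ) (s : ℕ) (h : ℝ) :
    compStrang A γ s h = compChi A (doubled γ) s h := by
  induction s with
  | zero => rfl
  | succ s ih =>
    have h1 : (2 * (s + 1) + 1) / 2 = s + 1 := by omega
    have h2 : (2 * (s + 1) - 1 + 1) / 2 = s + 1 := by omega
    rw [compStrang, compChi, ih, strang, doubled, doubled, h1, h2, div_mul_eq_mul_div]

theorem sum_abs_doubled (γ : ℕ → ℝ) (s : ℕ) :
    ∑ i ∈ Finset.Icc 1 (2 * s), |doubled γ i| = ∑ i ∈ Finset.Icc 1 s, |γ i| := by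
  induction s with
  | zero => simp
  | succ s ih =>
    have h1 : (2 * s + 1 + 1) / 2 = s + 1 := by omega
    have h2 : (2 * s + 1 + 1 + 1) / 2 = s + 1 := by omega
    rw [show 2 * (s + 1) = 2 * s + 1 + 1 by ring, Finset.sum_Icc_succ_top (by omega),
      Finset.sum_Icc_succ_top (by omega), Finset.sum_Icc_succ_top (by omega), ih, doubled, doubled,
      h1, h2, abs_div, abs_two]
    ring

variable [CompleteSpace H] {A : Fin N → H →L[𝕜] H}

/-- The error bound for alternating compositions, with the constant `1` in front of
`(∑ |αᵢ|) ^ (q + 1)`. -/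
theorem norm_compChi_sub_flow_le (hA : ∀ j, A j ∈ skewAdjoint (H →L[𝕜] H)) (α : ℕ → ℝ) (s : ℕ)
    {p : ℕ} (q : ℕ) (hord : HasOrder A (compChi A α s) p) {h : ℝ} (hh : 0 ≤ h) :
    ‖compChi A α s h - flow A h‖ ≤
      (∑ n ∈ Finset.Icc (p + 1) q, d n s α * (h * ∑ j, ‖A j‖) ^ n) +
        1 / ((q + 1)! : ℝ) * (1 + (∑ i ∈ Finset.Icc 1 (2 * s), |α i|) ^ (q + 1)) *
          (h * ∑ j, ‖A j‖) ^ (q + 1) := by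
  let _ : NormedAlgebra ℝ (H →L[𝕜] H) := NormedAlgebra.restrictScalars ℝ 𝕜 (H →L[𝕜] H)
  -- Real scalars act through `𝕜`, which makes the general result applicable to operators over `𝕜`.
  have hsmul : ∀ (t : ℝ) (B : H →L[𝕜] H), (t : 𝕜) • B = t • B := fun _ _ => rfl
  have : StarModule ℝ (H →L[𝕜] H) := ⟨fun t B => by
    rw [← hsmul, ← hsmul, star_smul, RCLike.star_def, RCLike.conj_ofReal,
      star_trivial t]⟩
  have hχ : ∀ t, chi A t = expProd (List.ofFn A) t := by
    intro t
    rw [chi, factors, expProd, List.map_ofFn]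
    rfl
  have hχs : ∀ t, chiStar A t = expProd (List.ofFn A).reverse t := by
    intro t
    rw [chiStar, factors, expProd, List.map_reverse, List.map_ofFn]
    rfl
  have hcomp : ∀ t, compChi A α s t =
      altComp (expProd (List.ofFn A)) (expProd (List.ofFn A).reverse) α s t := by
    clear hord
    intro t
    induction s with
    | zero => rfl
    | succ s ih => simp only [compChi, altComp, hχ, hχs, ih, Pi.mul_apply]
  have hflow : ∀ t, flow A t = exp (t • ∑ j, A j) := fun _ => rfl
  simp only [HasOrder, hcomp, hflow] at hord
  rw [hcomp, hflow]
  exact norm_altComp_expProd_sub_exp_le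
    A hA α s q hord hh

end Hilbert

end Splitting

theorem mainTheorem8 {𝕜 : Type*} [RCLike 𝕜] {H : Type*} [NormedAddCommGroup H]
    [InnerProductSpace 𝕜 H] [CompleteSpace H] {N : ℕ} (A : Fin N → H →L[𝕜] H)
    (hA : ∀ j, A j ∈ skewAdjoint (H →L[𝕜] H)) (a : Fin N → ℝ) (ha : ∀ j, ‖A j‖ = a j) :
    (∀ (s : ℕ) (α : ℕ → ℝ) (p q : ℕ), Splitting.HasOrder A (Splitting.compChi A α s) p → p < q →
      ∀ h : ℝ, 0 ≤ h →
        ‖Splitting.compChi A α s h - Splitting.flow A h‖ ≤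
          (∑ n ∈ Finset.Icc (p + 1) q, Splitting.d n s α * (h * ∑ j, a j) ^ n) +
            1 / ((q + 1) ! : ℝ) * (1 + 2 * (∑ i ∈ Finset.Icc 1 (2 * s), |α i|) ^ (q + 1)) *
              (h * ∑ j, a j) ^ (q + 1)) ∧
    (∀ (s : ℕ) (γ : ℕ → ℝ) (p q : ℕ), Splitting.HasOrder A (Splitting.compStrang A γ s) p → p ≤ q →
      ∀ h : ℝ, 0 ≤ h →
        ‖Splitting.compStrang A γ s h - Splitting.flow A h‖ ≤
          (∑ n ∈ Finset.Icc (p + 1) q, Splitting.dStrang n s γ * (h * ∑ j, a j) ^ n) +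
            1 / ((q + 1) ! : ℝ) * (1 + (∑ i ∈ Finset.Icc 1 s, |γ i|) ^ (q + 1)) *
              (h * ∑ j, a j) ^ (q + 1)) := by
  obtain rfl : a = fun j => ‖A j‖ := funext fun j => (ha j).symm
  refine ⟨fun s α p q hord _ h hh => ?_, fun s γ p q hord _ h hh => ?_⟩
  · have hα : 0 ≤ (∑ i ∈ Finset.Icc 1 (2 * s), |α i|) ^ (q + 1) := by positivity
    refine (Splitting.norm_compChi_sub_flow_le hA α s q hord hh).trans ?_
    gcongr
    linarith
  · rw [funext (Splitting.compStrang_eq_compChi A γ s)] at hord ⊢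
    rw [← Splitting.sum_abs_doubled]
    exact Splitting.norm_compChi_sub_flow_le hA (Splitting.doubled γ) s q hord hh
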